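/- Let $k$ be a commutative Noetherian ring and $m \geq 1$ an integer. Let $\mathrm{FI}$ be the category whose objects are the finite sets $[n]=\{1,\dots,n\}$, $n\ge 0$, and whose morphisms are the injections, and let $\mathrm{FI}^m$ be its $m$-fold product; its objects are the vectors $\mathbf n\in\mathbb N^m$. An $\mathrm{FI}^m$-module is a functor $V$ from $\mathrm{FI}^m$ to $k$-modules; write $V_{\mathbf n}$ for its value at $\mathbf n$. For $\mathbf r\in\mathbb N^m$, put $\mathfrak S_{\mathbf r}=\mathfrak S_{r_1}\times\cdots\times\mathfrak S_{r_m}$. For a $k[\mathfrak S_{\mathbf r}]$-module $W$, the induced module $M(W)$ is given by $M(W)_{\mathbf n}=k[\mathrm{Hom}_{\mathrm{FI}^m}(\mathbf r,\mathbf n)]\otimes_{k[\mathfrak S_{\mathbf r}]}W$, with morphisms of $\mathrm{FI}^m$ acting by composition on the left factor. An $\mathrm{FI}^m$-module $V$ is semi-induced if it has a finite filtration $0=V_0\subseteq V_1\subseteq\cdots\subseteq V_l=V$ by submodules such that every quotient $V_{i+1}/V_i$ is isomorphic to an induced module $M(W_i)$ (where $\mathbf r$ may depend on $i$). An element $v\in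 V_{\mathbf n}$ is $B$-torsion if it is killed by the map induced by some morphism $f_1\times\cdots\times f_m$ out of $\mathbf n$ for which at least one $f_j$ is not invertible. The $B$-torsion elements form a submodule $V_T\subseteq V$; the functor $V\mapsto V_T$ is left exact, and $H^i_B$ denotes its $i$-th right derived functor. If $V$ is a semi-induced $\mathrm{FI}^m$-module, then $H^i_B(V)=0$ for all $i\geq 0$. -/

import Mathlib

open CategoryTheory CategoryTheory.Limits

set_option maxSynthPendingDepth 3

universe u

/-- The category `FI`: an object is a natural number `n`, standing for the finite set
`[n]` with `n` elements. -/
structure FI : Type where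
  /-- the number of elements -/
  n : ℕ

namespace FI

/-- Morphisms of `FI` are the injections. -/
instance : SmallCategory FI where
  Hom a b := Fin a.n ↪ Fin b.n
  id a := Function.Embedding.refl _
  comp f g := Function.Embedding.trans f g

/-- The underlying injection of a morphism of `FI`. -/
def emb {a b : FI} (f : a ⟶ b) : Fin a.n ↪ Fin b.n := f

theorem comp_emb {a b c : FI} (f : a ⟶ b) (g : b ⟶ c) (x : Fin a.n) :
    emb (f ≫ g) x = emb g (emb f x) := rfl

theorem hom_ext {a b : FI} {f g : a ⟶ b} (h : ∀ x, emb f x = emb g x) : f = g :=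
  Function.Embedding.ext h

theorem le_of_hom {a b : FI} (f : a ⟶ b) : a.n ≤ b.n := by
  simpa using Fintype.card_le_of_embedding (emb f)

theorem isIso_of_le {a b : FI} (f : a ⟶ b) (h : b.n ≤ a.n) : IsIso f := by
  have hbij : Function.Bijective (emb f) :=
    (Fintype.bijective_iff_injective_and_card _).2
      ⟨(emb f).injective, by simpa using le_antisymm (le_of_hom f) h⟩
  refine ⟨⟨(Equiv.ofBijective _ hbij).symm.toEmbedding, ?_, ?_⟩⟩
  · exact hom_ext fun x => (Equiv.ofBijective _ hbij).symm_apply_apply x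
  · exact hom_ext fun x => (Equiv.ofBijective _ hbij).apply_symm_apply x

theorem not_isIso_of_lt {a b : FI} (f : a ⟶ b) (h : a.n < b.n) : ¬ IsIso f := fun _ =>
  absurd (le_of_hom (inv f)) (not_le.2 h)

theorem not_isIso_iff {a b : FI} (f : a ⟶ b) : ¬ IsIso f ↔ a.n < b.n :=
  ⟨fun h => not_le.1 fun h' => h (isIso_of_le f h'), not_isIso_of_lt f⟩

/-- Any two injections out of the same set can be completed to a commutative square whose
last corner has as many elements as the two given targets together. -/
theorem exists_square {a b c : FI} (f : a ⟶ b) (g : a ⟶ c) :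
    ∃ (f' : b ⟶ ⟨b.n + c.n⟩) (g' : c ⟶ ⟨b.n + c.n⟩), f ≫ f' = g ≫ g' := by
  classical
  let G : Fin c.n → Fin (b.n + c.n) := fun x =>
    if h : ∃ y, emb g y = x then Fin.castAdd c.n (emb f h.choose) else Fin.natAdd b.n x
  have hG : ∀ y, G (emb g y) = Fin.castAdd c.n (emb f y) := fun y => by
    have h : ∃ y', emb g y' = emb g y := ⟨y, rfl⟩
    have h2 : h.choose = y := (emb g).injective h.choose_spec
    simp only [G, dif_pos h, h2]
  have hinj : Function.Injective G := by
    intro x x' hx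
    by_cases h : ∃ y, emb g y = x <;> by_cases h' : ∃ y, emb g y = x'
    · obtain ⟨y, rfl⟩ := h
      obtain ⟨y', rfl⟩ := h'
      rw [hG, hG] at hx
      rw [(emb f).injective (Fin.castAdd_injective _ _ hx)]
    · obtain ⟨y, rfl⟩ := h
      rw [hG] at hx
      simp only [G, dif_neg h'] at hx
      have := congrArg Fin.val hx
      simp only [Fin.val_castAdd, Fin.val_natAdd] at this
      have := (emb f y).isLt
      omega
    · obtain ⟨y', rfl⟩ := h'
      rw [hG] at hx
      simp only [G, dif_neg h] at hx
      have := congrArg Fin.val hx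
      simp only [Fin.val_castAdd, Fin.val_natAdd] at this
      have := (emb f y').isLt
      omega
    · simp only [G, dif_neg h, dif_neg h'] at hx
      exact Fin.natAdd_injective _ _ hx
  refine ⟨Fin.castAddEmb c.n, ⟨G, hinj⟩, hom_ext fun y => ?_⟩
  exact (hG y).symm

end FI

/-- The `m`-fold product category of `FI` with itself. -/
abbrev FIPow (m : ℕ) : Type := Fin m → FI

/-- The category of `FI^m`-modules over `k`. -/
abbrev FIModule (k : Type u) [CommRing k] (m : ℕ) := FIPow m ⥤ ModuleCat.{u} k

namespace FIPow

variable {m : ℕ}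

/-- The product of symmetric groups `𝔖_r = 𝔖_{r_1} × ⋯ × 𝔖_{r_m}`. -/
abbrev SymGroup (r : FIPow m) : Type := ∀ j, Equiv.Perm (Fin (r j).n)

/-- An element of `𝔖_r`, as an endomorphism of `r` in `FI^m`. -/
def permHom {r : FIPow m} (σ : SymGroup r) : r ⟶ r :=
  fun j => (σ j).toEmbedding

/-- A morphism `f_1 × ⋯ × f_m` of `FI^m` induces transition maps if at least one `f_j` is
not invertible. -/
def IsTransition {a b : FIPow m} (f : a ⟶ b) : Prop := ∃ j, ¬ IsIso (f j)

theorem IsTransition.comp {a b c : FIPow m} {f : a ⟶ b} (hf : IsTransition f) (g : b ⟶ c) :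
    IsTransition (f ≫ g) := by
  obtain ⟨j, hj⟩ := hf
  exact ⟨j, FI.not_isIso_of_lt _
    (lt_of_lt_of_le ((FI.not_isIso_iff _).1 hj) (FI.le_of_hom (g j)))⟩

theorem exists_square {a b c : FIPow m} (f : a ⟶ b) (g : a ⟶ c) (hf : IsTransition f) :
    ∃ (d : FIPow m) (f' : b ⟶ d) (g' : c ⟶ d), f ≫ f' = g ≫ g' ∧ IsTransition g' := by
  choose f' g' h using fun j => FI.exists_square (f j) (g j)
  refine ⟨_, f', g', funext h, ?_⟩
  obtain ⟨j, hj⟩ := hf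
  refine ⟨j, FI.not_isIso_of_lt _ ?_⟩
  have := (FI.not_isIso_iff _).1 hj
  simp only
  omega

theorem exists_isTransition [NeZero m] (a : FIPow m) :
    ∃ (b : FIPow m) (f : a ⟶ b), IsTransition f :=
  ⟨fun j => ⟨(a j).n + 1⟩, fun _ => Fin.castSuccEmb, 0, FI.not_isIso_of_lt _ (Nat.lt_succ_self _)⟩

end FIPow

namespace FIModule

open FIPow

variable {k : Type u} [CommRing k] {m : ℕ}

/-! ### Induced and semi-induced modules -/

section Induced

open TensorProduct

variable {r : FIPow m} {W : Type u} [AddCommGroup W] [Module k W]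
  (ρ : Representation k (SymGroup r) W)

/-- The relations `fσ ⊗ w = f ⊗ σw` that turn `k[Hom(r, n)] ⊗_k W` into
`k[Hom(r, n)] ⊗_{k[𝔖_r]} W`. -/
noncomputable def inducedRel (n : FIPow m) : Submodule k (((r ⟶ n) →₀ k) ⊗[k] W) :=
  Submodule.span k
    {x | ∃ (f : r ⟶ n) (σ : SymGroup r) (w : W),
      x = Finsupp.single (permHom σ ≫ f) 1 ⊗ₜ[k] w - Finsupp.single f 1 ⊗ₜ[k] ρ σ w}

/-- Composition with `g : n ⟶ n'` on the left factor of `k[Hom(r, n)] ⊗_k W`. -/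
noncomputable def inducedMapAux (r : FIPow m) (W : Type u) [AddCommGroup W] [Module k W]
    {n n' : FIPow m} (g : n ⟶ n') :
    ((r ⟶ n) →₀ k) ⊗[k] W →ₗ[k] ((r ⟶ n') →₀ k) ⊗[k] W :=
  TensorProduct.map (Finsupp.lmapDomain k k fun f : r ⟶ n => f ≫ g) LinearMap.id

theorem inducedRel_le_comap {n n' : FIPow m} (g : n ⟶ n') :
    inducedRel ρ n ≤ (inducedRel ρ n').comap (inducedMapAux r W g) := by
  refine Submodule.span_le.2 ?_
  rintro _ ⟨f, σ, w, rfl⟩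
  refine Submodule.subset_span ⟨f ≫ g, σ, w, ?_⟩
  simp [inducedMapAux, Finsupp.mapDomain_single]

/-- The induced `FI^m`-module `M(W)`, with `M(W)_n = k[Hom(r, n)] ⊗_{k[𝔖_r]} W`. -/
noncomputable def induced : FIModule k m where
  obj n := ModuleCat.of k ((((r ⟶ n) →₀ k) ⊗[k] W) ⧸ inducedRel ρ n)
  map g := ModuleCat.ofHom (Submodule.mapQ _ _ (inducedMapAux r W g) (inducedRel_le_comap ρ g))
  map_id n := by
    ext : 1
    refine Submodule.linearMap_qext _ (TensorProduct.ext' fun x w => ?_)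
    have h : (fun f : r ⟶ n => f) = id := rfl
    simp [inducedMapAux, h]
  map_comp g h := by
    ext : 1
    refine Submodule.linearMap_qext _ (TensorProduct.ext' fun x w => ?_)
    simp [inducedMapAux, ← Finsupp.mapDomain_comp, Function.comp_def]

end Induced

/-- `V` is isomorphic to `M(W)` for some `r` and some `k[𝔖_r]`-module `W`. -/
def IsInduced (V : FIModule k m) : Prop :=
  ∃ (r : FIPow m) (W : Type u) (_ : AddCommGroup W) (_ : Module k W)
    (ρ : Representation k (SymGroup r) W), Nonempty (V ≅ induced ρ)

/-- `V` admits a finite filtration `0 = V_0 ⊆ V_1 ⊆ ⋯ ⊆ V_l = V` each of whose quotients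
`V_{i+1} / V_i` is isomorphic to an induced module. -/
def IsSemiInduced (V : FIModule k m) : Prop :=
  ∃ (l : ℕ) (F : Fin (l + 1) → Subobject V), F 0 = ⊥ ∧ F (Fin.last l) = ⊤ ∧
    ∀ i : Fin l, ∃ h : F i.castSucc ≤ F i.succ,
      IsInduced (cokernel (Subobject.ofLE (F i.castSucc) (F i.succ) h))

/-! ### The `B`-torsion functor and local cohomology -/

/-- An element of `V_n` is `B`-torsion if some transition map out of `V_n` kills it. -/
def IsTorsionElt (V : FIModule k m) (n : FIPow m) (v : V.obj n) : Prop :=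
  ∃ (r : FIPow m) (f : n ⟶ r), IsTransition f ∧ V.map f v = 0

theorem IsTorsionElt.map {V : FIModule k m} {n n' : FIPow m} {v : V.obj n}
    (hv : IsTorsionElt V n v) (g : n ⟶ n') : IsTorsionElt V n' (V.map g v) := by
  obtain ⟨r, f, hf, h0⟩ := hv
  obtain ⟨d, f', g', hsq, hg'⟩ := FIPow.exists_square f g hf
  refine ⟨d, g', hg', ?_⟩
  rw [← ModuleCat.comp_apply, ← V.map_comp, ← hsq, V.map_comp, ModuleCat.comp_apply, h0, map_zero]

theorem IsTorsionElt.app {V V' : FIModule k m} (φ : V ⟶ V') {n : FIPow m} {v : V.obj n}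
    (hv : IsTorsionElt V n v) : IsTorsionElt V' n (φ.app n v) := by
  obtain ⟨r, f, hf, h0⟩ := hv
  refine ⟨r, f, hf, ?_⟩
  rw [← ModuleCat.comp_apply, ← φ.naturality, ModuleCat.comp_apply, h0, map_zero]

variable [NeZero m]

/-- The `B`-torsion elements of `V_n`. -/
def torsionSubmodule (V : FIModule k m) (n : FIPow m) : Submodule k (V.obj n) where
  carrier := {v | IsTorsionElt V n v}
  zero_mem' := by
    obtain ⟨b, f, hf⟩ := exists_isTransition n
    exact ⟨b, f, hf, map_zero _⟩
  add_mem' := by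
    rintro v w ⟨b, f, hf, hv⟩ ⟨c, g, hg, hw⟩
    obtain ⟨d, f', g', hsq, -⟩ := FIPow.exists_square f g hf
    refine ⟨d, f ≫ f', hf.comp f', ?_⟩
    rw [map_add]
    nth_rewrite 2 [hsq]
    rw [V.map_comp, V.map_comp, ModuleCat.comp_apply, ModuleCat.comp_apply, hv, hw, map_zero,
      map_zero, add_zero]
  smul_mem' := by
    rintro c v ⟨b, f, hf, hv⟩
    exact ⟨b, f, hf, by rw [map_smul, hv, smul_zero]⟩

/-- The submodule `V_T` of `V` formed by its `B`-torsion elements. -/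
def torsion (V : FIModule k m) : FIModule k m where
  obj n := ModuleCat.of k (torsionSubmodule V n)
  map g := ModuleCat.ofHom ((V.map g).hom.restrict fun _ hv => IsTorsionElt.map hv g)
  map_id n := by
    ext x
    exact ConcreteCategory.congr_hom (V.map_id n) x.1
  map_comp g h := by
    ext x
    exact ConcreteCategory.congr_hom (V.map_comp g h) x.1

variable (k m)

/-- The `B`-torsion functor `V ↦ V_T`. -/
def torsionFunctor : FIModule k m ⥤ FIModule k m where
  obj V := torsion V
  map φ :=
    { app := fun n => ModuleCat.ofHom ((φ.app n).hom.restrict fun _ hv => IsTorsionElt.app φ hv)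
      naturality := fun n n' g => by
        ext x
        exact Subtype.ext (ConcreteCategory.congr_hom (φ.naturality g) x.1) }
  map_id V := by
    ext n x
    exact Subtype.ext rfl
  map_comp φ ψ := by
    ext n x
    exact Subtype.ext rfl

instance : (torsionFunctor k m).Additive where
  map_add := by
    intro V V' φ ψ
    ext n x
    exact Subtype.ext rfl

/-- The category of `FI^m`-modules is a Grothendieck abelian category, so it has enough
injectives. -/
instance isGrothendieckAbelian (k : Type u) [CommRing k] (m : ℕ) :
    IsGrothendieckAbelian.{u} (FIModule k m) := by
  have : HasCoproducts.{0} (ModuleCat.{u} k) := hasCoproducts_shrink.{0, u}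
  have : HasSeparator (FIModule k m) :=
    HasSeparator.of_equivalence
      ((opOpEquivalence (FIPow m)).congrLeft (E := ModuleCat.{u} k))
  have : AB5OfSize.{u, u} (FIModule k m) := ⟨fun _ _ _ => inferInstance⟩
  exact { }

/-- The `i`-th local cohomology functor `H^i_B`, the `i`-th right derived functor of the
`B`-torsion functor. -/
noncomputable def localCohomology (i : ℕ) : FIModule k m ⥤ FIModule k m :=
  (torsionFunctor k m).rightDerived i

end FIModule

/-!
Let `Σ` be the shift of `FI^m`-modules by `(1, …, 1)`. It is exact, it commutes with the torsion
functor, and it preserves injectives because its left adjoint, a left Kan extension, is computed by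
coproducts and hence preserves monomorphisms. So `H^i_B(Σ V) = Σ H^i_B(V)`, and the natural map
`V ⟶ Σ V` induces the natural map `H^i_B(V) ⟶ Σ H^i_B(V)`.

On an induced module `V = M(W)` the natural map `V ⟶ Σ V` is split by discarding the injections
that meet the new points. Hence `H^i_B(V) ⟶ Σ H^i_B(V)` is a monomorphism. By iteration the
transition maps of `H^i_B(V)` along arbitrarily long standard inclusions are injective, so
`H^i_B(V)` is torsion-free; being a subquotient of a complex of torsion modules it is also torsion,
so it vanishes. Semi-induced modules follow from the exactness of `H^i_B(V₁) ⟶ H^i_B(V₂) ⟶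
H^i_B(V₃)` for short exact sequences.
-/

universe v₁ v₂ v₃ u₁ u₂ u₃

/-! ### Termwise split epimorphisms of injective resolutions -/

section QuasiIso

open Abelian HomologicalComplex HomologicalComplex.HomologySequence

variable {C ι : Type*} [Category* C] [Abelian C] {c : ComplexShape ι}
  {S₁ S₂ : ShortComplex (HomologicalComplex C c)}

theorem quasiIso_τ₁_of_shortExact (φ : S₁ ⟶ S₂) (hS₁ : S₁.ShortExact) (hS₂ : S₂.ShortExact)
    (h₂ : QuasiIso φ.τ₂) (h₃ : QuasiIso φ.τ₃) : QuasiIso φ.τ₁ where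
  quasiIsoAt i := by
    rw [quasiIsoAt_iff_isIso_homologyMap]
    by_cases hi : ∃ j, c.Rel j i
    · obtain ⟨j, hji⟩ := hi
      exact isIso_of_epi_of_isIso_of_isIso_of_mono
        (composableArrows₅_exact hS₁ j i hji).δ₀ (composableArrows₅_exact hS₂ j i hji).δ₀
        (ComposableArrows.δ₀Functor.map (mapComposableArrows₅ φ hS₁ hS₂ j i hji))
        (inferInstanceAs (Epi (homologyMap φ.τ₂ j)))
        (inferInstanceAs (IsIso (homologyMap φ.τ₃ j)))
        (inferInstanceAs (IsIso (homologyMap φ.τ₂ i)))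
        (inferInstanceAs (Mono (homologyMap φ.τ₃ i)))
    · have := hS₁.mono_f
      have := hS₂.mono_f
      have hi : ∀ j, ¬ c.Rel j i := not_exists.1 hi
      exact isIso_of_isIso_of_mono (composableArrows₂_exact hS₁ i) (composableArrows₂_exact hS₂ i)
        (φ := mapComposableArrows₂ φ i)
        (mono_homologyMap_of_mono_of_not_rel _ _ hi)
        (mono_homologyMap_of_mono_of_not_rel _ _ hi)
        (inferInstanceAs (IsIso (homologyMap φ.τ₂ i)))
        (inferInstanceAs (Mono (homologyMap φ.τ₃ i)))

end QuasiIso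

section SndArrow

variable {C : Type u₁} [Category.{v₁} C] [Preadditive C] [HasBinaryBiproducts C]

/-- The second projection `I ⊞ J ⟶ J`, as an object of the category of arrows. A map into it from
`X₀ ⟶ X₁` is a pair of maps `X₀ ⟶ I` and `X₁ ⟶ J`, so it is injective when `I` and `J` are. -/
noncomputable def sndArrow (I J : C) : ComposableArrows C 1 :=
  ComposableArrows.mk₁ (biprod.snd : I ⊞ J ⟶ J)

namespace sndArrow

variable {I J : C}

/-- The map into `sndArrow I J` with components `a : X₀ ⟶ I` and `b : X₁ ⟶ J`. -/
noncomputable def lift {X : ComposableArrows C 1} (a : X.obj 0 ⟶ I) (b : X.obj 1 ⟶ J) :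
    X ⟶ sndArrow I J :=
  ComposableArrows.homMk₁ (biprod.lift a (X.map' 0 1 ≫ b)) b (biprod.lift_snd _ _).symm

/-- The projection `I ⊞ J ⟶ I` at the source of `sndArrow I J`. -/
noncomputable def fst (I J : C) : (sndArrow I J).obj 0 ⟶ I := biprod.fst (Y := J)

/-- The identification of the target of `sndArrow I J` with `J`. -/
noncomputable def snd (I J : C) : (sndArrow I J).obj 1 ⟶ J := 𝟙 J

theorem lift_app_zero_comp_fst {X : ComposableArrows C 1} (a : X.obj 0 ⟶ I) (b : X.obj 1 ⟶ J) :
    (lift a b).app 0 ≫ fst I J = a := biprod.lift_fst _ _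

theorem lift_app_one_comp_snd {X : ComposableArrows C 1} (a : X.obj 0 ⟶ I) (b : X.obj 1 ⟶ J) :
    (lift a b).app 1 ≫ snd I J = b := Category.comp_id _

theorem hom_ext {X : ComposableArrows C 1} {φ ψ : X ⟶ sndArrow I J}
    (h₀ : φ.app 0 ≫ fst I J = ψ.app 0 ≫ fst I J)
    (h₁ : φ.app 1 ≫ snd I J = ψ.app 1 ≫ snd I J) : φ = ψ := by
  have app_one_eq : φ.app 1 = ψ.app 1 :=
    (Category.comp_id _).symm.trans (h₁.trans (Category.comp_id _))
  have naturality (φ : X ⟶ sndArrow I J) :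
      X.map' 0 1 ≫ φ.app 1 = φ.app 0 ≫ (biprod.snd : I ⊞ J ⟶ J) := φ.naturality _
  exact ComposableArrows.hom_ext₁
    (biprod.hom_ext _ _ h₀ ((naturality φ).symm.trans (app_one_eq ▸ naturality ψ))) app_one_eq

instance injective (I J : C) [Injective I] [Injective J] [HasPullbacks C] :
    Injective (sndArrow I J) where
  factors {X Y} φ f _ := by
    refine ⟨lift (Injective.factorThru (φ.app 0 ≫ fst I J) (f.app 0))
      (Injective.factorThru (φ.app 1 ≫ snd I J) (f.app 1)), hom_ext ?_ ?_⟩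
    · rw [NatTrans.comp_app, Category.assoc, lift_app_zero_comp_fst, Injective.comp_factorThru]
    · rw [NatTrans.comp_app, Category.assoc, lift_app_one_comp_snd, Injective.comp_factorThru]

instance mono_lift {X : ComposableArrows C 1} (a : X.obj 0 ⟶ I) (b : X.obj 1 ⟶ J) [Mono a]
    [Mono b] : Mono (lift a b) := by
  have (i : Fin (1 + 1)) : Mono ((lift a b).app i) := by
    fin_cases i
    · exact mono_of_mono_fac (lift_app_zero_comp_fst a b)
    · exact mono_of_mono_fac (lift_app_one_comp_snd a b)
  exact NatTrans.mono_of_mono_app _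

instance injective_obj (I J : C) [Injective I] [Injective J] (i : Fin (1 + 1)) :
    Injective ((sndArrow I J).obj i) := by
  fin_cases i
  · exact inferInstanceAs (Injective (I ⊞ J))
  · exact inferInstanceAs (Injective J)

instance isSplitEpi_map (I J : C) (f : (0 : Fin (1 + 1)) ⟶ 1) :
    IsSplitEpi ((sndArrow I J).map f) :=
  inferInstanceAs (IsSplitEpi (biprod.snd : I ⊞ J ⟶ J))

end sndArrow

theorem isSplitEpi_map_of_retract {C : Type u₁} [Category.{v₁} C] {D : Type u₂} [Category.{v₂} D]
    {F G : C ⥤ D} (r : Retract F G) {X Y : C} (f : X ⟶ Y) [IsSplitEpi (G.map f)] :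
    IsSplitEpi (F.map f) :=
  ⟨⟨r.i.app Y ≫ section_ (G.map f) ≫ r.r.app X, by
    rw [Category.assoc, Category.assoc, ← r.r.naturality, IsSplitEpi.id_assoc]
    exact NatTrans.congr_app r.retract Y⟩⟩

end SndArrow

section InjectiveArrows

variable {C : Type u₁} [Category.{v₁} C] [Abelian C] [EnoughInjectives C]

instance enoughInjectives_composableArrows_one : EnoughInjectives (ComposableArrows C 1) where
  presentation X := ⟨{
    J := sndArrow (Injective.under (X.obj 0)) (Injective.under (X.obj 1))
    injective := inferInstance
    f := sndArrow.lift (Injective.ι _) (Injective.ι _)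
    mono := inferInstance }⟩

theorem exists_retract_sndArrow (X : ComposableArrows C 1) [Injective X] :
    ∃ (I J : C) (_ : Injective I) (_ : Injective J), Nonempty (Retract X (sndArrow I J)) := by
  let f := sndArrow.lift (Injective.ι (X.obj 0)) (Injective.ι (X.obj 1))
  exact ⟨_, _, inferInstance, inferInstance,
    ⟨f, Injective.factorThru (𝟙 X) f, Injective.comp_factorThru _ _⟩⟩

instance preservesInjectiveObjects_evaluation (i : Fin (1 + 1)) :
    ((evaluation (Fin (1 + 1)) C).obj i).PreservesInjectiveObjects where
  injective_obj {X} _ := by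
    obtain ⟨I, J, _, _, ⟨r⟩⟩ := exists_retract_sndArrow X
    exact Retract.injective (r.map ((evaluation (Fin (1 + 1)) C).obj i))
      (i := sndArrow.injective_obj I J i)

theorem isSplitEpi_map_of_injective (X : ComposableArrows C 1) [Injective X]
    (f : (0 : Fin (1 + 1)) ⟶ 1) : IsSplitEpi (X.map f) := by
  obtain ⟨I, J, _, _, ⟨r⟩⟩ := exists_retract_sndArrow X
  exact isSplitEpi_map_of_retract r f

end InjectiveArrows

section ExactImage

variable {C : Type u₁} [Category.{v₁} C] [Abelian C] {D : Type u₂} [Category.{v₂} D] [Abelian D]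
  {Z : C} (I : InjectiveResolution Z) (G : C ⥤ D) [G.Additive] [PreservesFiniteLimits G]
  [PreservesFiniteColimits G] [G.PreservesInjectiveObjects]

/-- The image of an injective resolution under an exact functor that preserves injective
objects. -/
noncomputable abbrev exactImage : InjectiveResolution (G.obj Z) where
  cocomplex := (G.mapHomologicalComplex _).obj I.cocomplex
  injective n := inferInstanceAs (Injective (G.obj (I.cocomplex.X n)))
  ι := (HomologicalComplex.singleMapHomologicalComplex G _ 0).inv.app Z ≫
    (G.mapHomologicalComplex _).map I.ι

theorem exactImage_ι_f_zero : (exactImage I G).ι.f 0 = G.map (I.ι.f 0) := by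
  rw [HomologicalComplex.comp_f, HomologicalComplex.singleMapHomologicalComplex_inv_app_self]
  exact (congrArg (fun f => (𝟙 _ ≫ f) ≫ G.map (I.ι.f 0)) (G.map_id Z)).trans (by simp)

end ExactImage

section SplitResolutions

variable {C : Type u₁} [Category.{v₁} C] [Abelian C]

theorem exists_injectiveResolution_map_isSplitEpi [EnoughInjectives C] {X Y : C} (g : X ⟶ Y) :
    ∃ (I : InjectiveResolution X) (J : InjectiveResolution Y) (β : I.cocomplex ⟶ J.cocomplex),
      I.ι.f 0 ≫ β.f 0 = g ≫ J.ι.f 0 ∧ ∀ n, IsSplitEpi (β.f n) := by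
  -- An injective arrow is a split epimorphism of injectives: resolve `g` in the category of arrows.
  let I := injectiveResolution (ComposableArrows.mk₁ g)
  let e : (0 : Fin (1 + 1)) ⟶ 1 := homOfLE zero_le_one
  refine ⟨exactImage I ((evaluation (Fin (1 + 1)) C).obj 0),
    exactImage I ((evaluation (Fin (1 + 1)) C).obj 1),
    (NatTrans.mapHomologicalComplex ((evaluation (Fin (1 + 1)) C).map e) _).app I.cocomplex,
    ?_, fun n => isSplitEpi_map_of_injective (I.cocomplex.X n) e⟩
  rw [exactImage_ι_f_zero, exactImage_ι_f_zero]
  exact ((evaluation (Fin (1 + 1)) C).map e).naturality (I.ι.f 0)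

theorem exists_injectiveResolution_of_isSplitEpi {S : ShortComplex C} (hS : S.ShortExact)
    (I₂ : InjectiveResolution S.X₂) (I₃ : InjectiveResolution S.X₃)
    (β : I₂.cocomplex ⟶ I₃.cocomplex) (hβ : I₂.ι.f 0 ≫ β.f 0 = S.g ≫ I₃.ι.f 0)
    (hsplit : ∀ n, IsSplitEpi (β.f n)) :
    ∃ (I₁ : InjectiveResolution S.X₁) (α : I₁.cocomplex ⟶ I₂.cocomplex) (w : α ≫ β = 0),
      I₁.ι.f 0 ≫ α.f 0 = S.f ≫ I₂.ι.f 0 ∧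
      ∀ n, Nonempty ((ShortComplex.mk α β w).map (HomologicalComplex.eval _ _ n)).Splitting := by
  let T := ShortComplex.mk (kernel.ι β) β (kernel.condition β)
  have := HomologicalComplex.epi_of_epi_f β inferInstance
  have hT : T.ShortExact := { exact := ShortComplex.exact_kernel β }
  let σ (n : ℕ) : (T.map (HomologicalComplex.eval _ _ n)).Splitting :=
    .ofExactOfSection _ (hT.map_of_exact (HomologicalComplex.eval _ _ n)).exact
      (hsplit n).exists_splitEpi.some.section_ (hsplit n).exists_splitEpi.some.id
      (hT.map_of_exact (HomologicalComplex.eval _ _ n)).mono_f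
  let S₀ := S.map (CochainComplex.single₀ C)
  let ι₂ : S₀.X₂ ⟶ T.X₂ := I₂.ι
  let ι₃ : S₀.X₃ ⟶ T.X₃ := I₃.ι
  have ι₂_comp_β : ι₂ ≫ β = S₀.g ≫ ι₃ := HomologicalComplex.from_single_hom_ext
    (hβ.trans (congrArg (· ≫ I₃.ι.f 0) (CochainComplex.single₀_map_f_zero S.g).symm))
  let φ : S₀ ⟶ T :=
    { τ₁ := kernel.lift β (S₀.f ≫ ι₂) (by
        rw [Category.assoc, ι₂_comp_β, S₀.zero_assoc, zero_comp])
      τ₂ := ι₂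
      τ₃ := ι₃
      comm₁₂ := kernel.lift_ι _ _ _
      comm₂₃ := ι₂_comp_β }
  let I₁ : InjectiveResolution S.X₁ :=
    { cocomplex := T.X₁
      injective n := Retract.injective ⟨(kernel.ι β).f n, (σ n).r, (σ n).f_r⟩
      ι := φ.τ₁
      quasiIso := quasiIso_τ₁_of_shortExact φ (hS.map_of_exact _) hT I₂.quasiIso I₃.quasiIso }
  have hα : I₁.ι.f 0 ≫ (kernel.ι β).f 0 = S.f ≫ I₂.ι.f 0 :=
    (HomologicalComplex.congr_hom φ.comm₁₂ 0).trans
      (congrArg (· ≫ I₂.ι.f 0) (CochainComplex.single₀_map_f_zero S.f))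
  exact ⟨I₁, kernel.ι β, kernel.condition β, hα, fun n => ⟨σ n⟩⟩

end SplitResolutions

/-! ### Right derived functors -/

theorem mono_of_comp_iso_eq {C : Type u₁} [Category.{v₁} C] {A B A' B' : C} {f : A ⟶ B}
    {g : A' ⟶ B'} (a : A ≅ A') (b : B ≅ B') (h : f ≫ b.hom = a.hom ≫ g) (hf : Mono f) :
    Mono g := by
  rw [(Iso.eq_inv_comp a).2 h.symm]
  infer_instance

section RightDerived

variable {C : Type u₁} [Category.{v₁} C] [Abelian C] {D : Type u₂} [Category.{v₂} D] [Abelian D]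

open ZeroObject in
instance preservesZeroMorphisms_rightDerived [EnoughInjectives C] (F : C ⥤ D) [F.Additive]
    (n : ℕ) : (F.rightDerived n).PreservesZeroMorphisms :=
  have isZero_homology :
      IsZero ((F.mapHomologicalComplex _ ⋙ HomologicalComplex.homologyFunctor _ _ n).obj
        (InjectiveResolution.self (0 : C)).cocomplex) :=
    Functor.map_isZero _ (Functor.map_isZero (CochainComplex.single₀ C) (isZero_zero C))
  Functor.preservesZeroMorphisms_of_map_zero_object
    ((InjectiveResolution.self (0 : C)).isoRightDerivedObj F n ≪≫ isZero_homology.isoZero)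

theorem exact_map_rightDerived [EnoughInjectives C] {S : ShortComplex C} (hS : S.ShortExact)
    (F : C ⥤ D) [F.Additive] (n : ℕ) : (S.map (F.rightDerived n)).Exact := by
  obtain ⟨I₂, I₃, β, hβ, hsplit⟩ := exists_injectiveResolution_map_isSplitEpi S.g
  obtain ⟨I₁, α, w, hα, σ⟩ := exists_injectiveResolution_of_isSplitEpi hS I₂ I₃ β hβ hsplit
  let T := (ShortComplex.mk α β w).map (F.mapHomologicalComplex _)
  have hT : T.ShortExact := HomologicalComplex.shortExact_of_degreewise_shortExact T
    fun i => ((σ i).some.map F).shortExact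
  exact (ShortComplex.exact_iff_of_iso (ShortComplex.isoMk (I₁.isoRightDerivedObj F n)
    (I₂.isoRightDerivedObj F n) (I₃.isoRightDerivedObj F n)
    (InjectiveResolution.isoRightDerivedObj_hom_naturality S.f I₁ I₂ α hα F n).symm
    (InjectiveResolution.isoRightDerivedObj_hom_naturality S.g I₂ I₃ β hβ F n).symm)).2
    (hT.homology_exact₂ n)

theorem mono_app_homology_of_mono_homologyMap {G G' : C ⥤ D} [G.Additive] [PreservesFiniteLimits G]
    [PreservesFiniteColimits G] [G'.Additive] [PreservesFiniteLimits G']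
    [PreservesFiniteColimits G'] (θ : G ⟶ G') (S : ShortComplex C)
    [Mono (ShortComplex.homologyMap (S.mapNatTrans θ))] : Mono (θ.app S.homology) := by
  rw [NatTrans.app_homology]
  infer_instance

theorem mono_app_rightDerived [HasInjectiveResolutions C] {F G : C ⥤ C} [F.Additive] [G.Additive]
    [PreservesFiniteLimits G] [PreservesFiniteColimits G] [G.PreservesInjectiveObjects]
    (η : 𝟭 C ⟶ G) (e : G ⋙ F ≅ F ⋙ G)
    (he : ∀ X, F.map (η.app X) ≫ e.hom.app X = η.app (F.obj X))
    (V : C) [IsSplitMono (η.app V)] (n : ℕ) : Mono (η.app ((F.rightDerived n).obj V)) := by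
  -- Computed with the resolutions `I` of `V` and `G I` of `G V`, the split monomorphism
  -- `RⁿF (η V)` is, up to `e`, the map `η (Hⁿ (F I))`.
  let I := injectiveResolution V
  let K := (F.mapHomologicalComplex (ComplexShape.up ℕ)).obj I.cocomplex
  let ψ : I.cocomplex ⟶ (exactImage I G).cocomplex :=
    (NatTrans.mapHomologicalComplex η (ComplexShape.up ℕ)).app I.cocomplex
  let ε := (NatIso.mapHomologicalComplex e (ComplexShape.up ℕ)).app I.cocomplex
  have ι_comp_ψ : I.ι.f 0 ≫ ψ.f 0 = η.app V ≫ (exactImage I G).ι.f 0 := by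
    rw [exactImage_ι_f_zero]
    exact η.naturality (I.ι.f 0)
  have map_ψ_comp_ε : (F.mapHomologicalComplex _).map ψ ≫ ε.hom =
      (NatTrans.mapHomologicalComplex η _).app K :=
    HomologicalComplex.hom_ext _ _ fun _ => he _
  have mono_map_ψ :
      Mono (HomologicalComplex.homologyMap ((F.mapHomologicalComplex _).map ψ) n) :=
    mono_of_comp_iso_eq (I.isoRightDerivedObj F n) ((exactImage I G).isoRightDerivedObj F n)
      (InjectiveResolution.isoRightDerivedObj_hom_naturality _ _ _ ψ ι_comp_ψ F n) inferInstance
  have mono_homologyMap_η : Mono (ShortComplex.homologyMap ((K.sc n).mapNatTrans η)) :=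
    mono_of_comp_iso_eq (Iso.refl _) (HomologicalComplex.homologyMapIso ε n)
      ((HomologicalComplex.homologyMap_comp _ _ n).symm.trans
        ((congrArg (HomologicalComplex.homologyMap · n) map_ψ_comp_ε).trans
          (Category.id_comp _).symm)) mono_map_ψ
  have mono_η_homology : Mono (η.app (K.homology n)) :=
    mono_app_homology_of_mono_homologyMap η (K.sc n)
  exact mono_of_comp_iso_eq ((𝟭 C).mapIso (I.isoRightDerivedObj F n).symm)
    (G.mapIso (I.isoRightDerivedObj F n).symm) (η.naturality _).symm mono_η_homology

end RightDerived

theorem preservesMonomorphisms_lan {C : Type u₁} [Category.{v₁} C] {D : Type u₂} [Category.{v₂} D]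
    (L : C ⥤ D) (E : Type u₃) [Category.{v₃} E] [HasPullbacks E]
    [∀ X, HasColimitsOfShape (CostructuredArrow L X) E]
    [∀ X, (colim : (CostructuredArrow L X ⥤ E) ⥤ E).PreservesMonomorphisms] :
    (L.lan : (C ⥤ E) ⥤ (D ⥤ E)).PreservesMonomorphisms where
  preserves {G₁ G₂} φ _ := by
    rw [NatTrans.mono_iff_mono_app]
    intro X
    have : Mono (Functor.whiskerLeft (CostructuredArrow.proj L X) φ) :=
      (NatTrans.mono_iff_mono_app _).2 fun _ => (NatTrans.mono_iff_mono_app φ).1 inferInstance _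
    refine colim.map_mono' (Functor.whiskerLeft (CostructuredArrow.proj L X) φ)
      (Functor.isPointwiseLeftKanExtensionLeftKanExtensionUnit L G₁ X)
      (Functor.isPointwiseLeftKanExtensionLeftKanExtensionUnit L G₂ X)
      ((L.lan.map φ).app X) fun T => ?_
    have lanUnit_naturality : φ.app T.left ≫ (L.lanUnit.app G₂).app T.left =
        (L.lanUnit.app G₁).app T.left ≫ (L.lan.map φ).app (L.obj T.left) :=
      NatTrans.congr_app (L.lanUnit.naturality φ) T.left
    change ((L.lanUnit.app G₁).app T.left ≫ (L.lan.obj G₁).map T.hom) ≫ (L.lan.map φ).app X =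
      φ.app T.left ≫ (L.lanUnit.app G₂).app T.left ≫ (L.lan.obj G₂).map T.hom
    rw [reassoc_of% lanUnit_naturality, Category.assoc, NatTrans.naturality]

/-! ### Adding a point -/

namespace FI

/-- The functor `[n] ↦ [n + 1]`, adding a new element `0` fixed by all morphisms. -/
def shift : FI ⥤ FI where
  obj a := ⟨a.n + 1⟩
  map {a b} f :=
    (⟨Fin.cases 0 fun i => (emb f i).succ, by
      intro x y
      refine Fin.cases ?_ (fun x => ?_) x <;> refine Fin.cases ?_ (fun y => ?_) y
      · simp
      · simpa using fun h => (Fin.succ_ne_zero _ h.symm).elim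
      · simp
      · simp⟩ : Fin (a.n + 1) ↪ Fin (b.n + 1))
  map_id a := hom_ext fun x => by
    refine Fin.cases ?_ (fun x => ?_) x <;> rfl
  map_comp f g := hom_ext fun x => by
    refine Fin.cases ?_ (fun x => ?_) x <;> rfl

/-- The inclusion `[n] ⟶ [n + 1]` missing the new element. -/
def unit : 𝟭 FI ⟶ shift where
  app a := Fin.succEmb a.n
  naturality _ _ _ := hom_ext fun _ => rfl

/-- The new element of `[n + 1]`. -/
def base (a : FI) : Fin (shift.obj a).n := (0 : Fin (a.n + 1))

instance (a : FI) : Mono (unit.app a) where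
  right_cancellation _ _ h := hom_ext fun x =>
    Fin.succ_injective _ (congrArg (fun φ => emb φ x) h)

instance : shift.Faithful where
  map_injective h := hom_ext fun x =>
    Fin.succ_injective _ (congrArg (fun φ => emb φ (Fin.succ x)) h)

theorem exists_comp_unit_eq_iff {a b : FI} (f : a ⟶ shift.obj b) :
    (∃ g : a ⟶ b, g ≫ unit.app b = f) ↔ ∀ i, emb f i ≠ base b := by
  constructor
  · rintro ⟨g, rfl⟩ i
    exact Fin.succ_ne_zero _
  · intro hf
    exact ⟨(⟨fun i => Fin.pred _ (hf i), fun _ _ hij => (emb f).injective (Fin.pred_inj.1 hij)⟩ :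
      Fin a.n ↪ Fin b.n), hom_ext fun i => Fin.succ_pred _ (hf i)⟩

theorem exists_comp_unit_eq_of_comp_shift_map_eq {a b c : FI} (f : a ⟶ shift.obj b) (h : b ⟶ c)
    {g : a ⟶ c} (hg : f ≫ shift.map h = g ≫ unit.app c) : ∃ g' : a ⟶ b, g' ≫ unit.app b = f := by
  refine (exists_comp_unit_eq_iff f).2 fun i hi => (exists_comp_unit_eq_iff _).1 ⟨g, hg.symm⟩ i ?_
  rw [comp_emb, hi]
  rfl

theorem exists_shift_map_eq {a b : FI} (h : shift.obj a ⟶ shift.obj b)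
    (h₀ : emb h (base a) = base b) : ∃ g, shift.map g = h := by
  obtain ⟨g, hg⟩ := (exists_comp_unit_eq_iff (unit.app a ≫ h)).2 fun i hi =>
    Fin.succ_ne_zero i ((emb h).injective (hi.trans h₀.symm))
  exact ⟨g, hom_ext (Fin.cases h₀.symm fun i => congrArg (fun φ => emb φ i) hg)⟩

theorem exists_shift_map_comp_eq {a b x : FI} (φ : shift.obj b ⟶ x) [IsIso φ]
    (ψ : shift.obj a ⟶ x) (h : emb ψ (base a) = emb φ (base b)) :
    ∃ g, shift.map g ≫ φ = ψ := by
  obtain ⟨g, hg⟩ := exists_shift_map_eq (ψ ≫ inv φ) (by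
    apply (emb φ).injective
    rw [← comp_emb, Category.assoc, IsIso.inv_hom_id, Category.comp_id, h])
  exact ⟨g, by rw [hg, Category.assoc, IsIso.inv_hom_id, Category.comp_id]⟩

theorem exists_isIso_shift {a : FI} (e : Fin a.n) :
    ∃ (b : FI) (φ : shift.obj b ⟶ a), IsIso φ ∧ emb φ (base b) = e := by
  obtain ⟨_ | n⟩ := a
  · exact e.elim0
  · refine ⟨⟨n⟩, (Equiv.swap 0 e).toEmbedding, isIso_of_le _ le_rfl, ?_⟩
    exact Equiv.swap_apply_left 0 e

/-- The complement of the element `e` of `a`. -/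
noncomputable def compl {a : FI} (e : Fin a.n) : FI := (exists_isIso_shift e).choose

/-- The bijection between `a` and the complement of `e` with a new element added, which is sent
to `e`. -/
noncomputable def complHom {a : FI} (e : Fin a.n) : shift.obj (compl e) ⟶ a :=
  (exists_isIso_shift e).choose_spec.choose

instance {a : FI} (e : Fin a.n) : IsIso (complHom e) :=
  (exists_isIso_shift e).choose_spec.choose_spec.1

theorem emb_complHom_base {a : FI} (e : Fin a.n) : emb (complHom e) (base _) = e :=
  (exists_isIso_shift e).choose_spec.choose_spec.2

theorem exists_comp_eq {a b c : FI} (f : a ⟶ b) (g : a ⟶ c) (h : b.n ≤ c.n) :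
    ∃ g' : b ⟶ c, f ≫ g' = g := by
  obtain ⟨σ, hσ⟩ := (Equiv.Perm.isMultiplyPretransitive (Fin c.n) a.n).exists_smul_eq
    ((emb f).trans (Fin.castLEEmb h)) (emb g)
  exact ⟨(Fin.castLEEmb h).trans σ.toEmbedding, hσ⟩

end FI

namespace FIPow

variable {m : ℕ}

theorem isIso_permHom {r : FIPow m} (σ : SymGroup r) : IsIso (permHom σ) :=
  ⟨permHom σ⁻¹, funext fun j => FI.hom_ext fun x => (σ j).symm_apply_apply x,
    funext fun j => FI.hom_ext fun x => (σ j).apply_symm_apply x⟩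

/-- The functor `n ↦ n + (1, …, 1)` on `FI^m`. -/
def shift (m : ℕ) : FIPow m ⥤ FIPow m := Functor.pi fun _ => FI.shift

/-- The inclusion `n ⟶ n + (1, …, 1)` missing the new elements. -/
def unit (m : ℕ) : 𝟭 (FIPow m) ⟶ shift m where
  app a j := FI.unit.app (a j)
  naturality _ _ f := funext fun j => FI.unit.naturality (f j)

theorem comp_unit_app {a b : FIPow m} (f : a ⟶ b) :
    f ≫ (unit m).app b = (unit m).app a ≫ (shift m).map f :=
  (unit m).naturality f

theorem comp_unit_app_injective (a b : FIPow m) :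
    Function.Injective fun f : a ⟶ b => f ≫ (unit m).app b := fun _ _ h =>
  funext fun j => (cancel_mono (FI.unit.app (b j))).1 (congrFun h j)

theorem exists_comp_unit_eq_of_comp_shift_map_eq {a b c : FIPow m} (f : a ⟶ (shift m).obj b)
    (h : b ⟶ c) {g : a ⟶ c} (hg : f ≫ (shift m).map h = g ≫ (unit m).app c) :
    ∃ g' : a ⟶ b, g' ≫ (unit m).app b = f := by
  choose g' hg' using fun j =>
    FI.exists_comp_unit_eq_of_comp_shift_map_eq (f j) (h j) (congrFun hg j)
  exact ⟨g', funext hg'⟩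

theorem exists_comp_eq {a b c : FIPow m} (f : a ⟶ b) (g : a ⟶ c) (h : ∀ j, (b j).n ≤ (c j).n) :
    ∃ g' : b ⟶ c, f ≫ g' = g := by
  choose g' hg' using fun j => FI.exists_comp_eq (f j) (g j) (h j)
  exact ⟨g', funext hg'⟩

section Pointed

variable {x : FIPow m} (d : CostructuredArrow (shift m) x) (e : ∀ j, Fin (x j).n)

/-- The complement of a point `e` of `x`, as an object over `x`. These objects are terminal in the
connected components of `CostructuredArrow (shift m) x`. -/
noncomputable def pointed : CostructuredArrow (shift m) x :=
  CostructuredArrow.mk (Y := fun j => FI.compl (e j)) fun j => FI.complHom (e j)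

/-- The components of the structure morphism of an object over `x`. -/
def component (j : Fin m) : FI.shift.obj (d.left j) ⟶ x j := d.hom j

/-- The image in `x` of the new elements, for an object over `x`. -/
def basePoint (j : Fin m) : Fin (x j).n := FI.emb (component d j) (FI.base _)

theorem nonempty_hom_pointed_basePoint : Nonempty (d ⟶ pointed (basePoint d)) := by
  choose g hg using fun j => FI.exists_shift_map_comp_eq (FI.complHom (basePoint d j))
    (component d j) (FI.emb_complHom_base (basePoint d j)).symm
  exact ⟨CostructuredArrow.homMk g (funext hg)⟩

variable {d e}

theorem shift_map_left_comp_complHom (f : d ⟶ pointed e) (j : Fin m) :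
    FI.shift.map (f.left j) ≫ FI.complHom (e j) = component d j :=
  congrFun (CostructuredArrow.w f) j

theorem basePoint_eq_of_hom (f : d ⟶ pointed e) : basePoint d = e := by
  funext j
  rw [basePoint, ← shift_map_left_comp_complHom f j]
  exact FI.emb_complHom_base (e j)

instance : Subsingleton (d ⟶ pointed e) where
  allEq f g := by
    ext : 1
    refine funext fun j => FI.shift.map_injective ((cancel_mono (FI.complHom (e j))).1 ?_)
    exact (shift_map_left_comp_complHom f j).trans (shift_map_left_comp_complHom g j).symm

variable (x) in
instance final_discrete_pointed :
    (Discrete.functor (pointed : (∀ j, Fin (x j).n) → CostructuredArrow (shift m) x)).Final where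
  out d := by
    obtain ⟨f⟩ := nonempty_hom_pointed_basePoint d
    have : Nonempty (StructuredArrow d (Discrete.functor
      (pointed : (∀ j, Fin (x j).n) → CostructuredArrow (shift m) x))) :=
      ⟨StructuredArrow.mk (Y := Discrete.mk _) f⟩
    refine zigzag_isConnected fun X Y => ?_
    obtain ⟨⟨⟨⟩⟩, ⟨e⟩, (f : d ⟶ pointed e)⟩ := X
    obtain ⟨⟨⟨⟩⟩, ⟨e'⟩, (f' : d ⟶ pointed e')⟩ := Y
    obtain rfl : e = e' := (basePoint_eq_of_hom f).symm.trans (basePoint_eq_of_hom f')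
    obtain rfl : f = f' := Subsingleton.elim f f'
    exact Zigzag.refl _

end Pointed

end FIPow

/-! ### Shift and torsion -/

namespace FIModule

section Shift

variable (k : Type u) [CommRing k] (m : ℕ)

/-- The shift functor `V ↦ V_{• + (1, …, 1)}`. -/
abbrev shift : FIModule k m ⥤ FIModule k m :=
  (Functor.whiskeringLeft _ _ _).obj (FIPow.shift m)

/-- The natural map from a module to its shift. -/
def shiftUnit : 𝟭 (FIModule k m) ⟶ shift k m where
  app V :=
    { app n := V.map ((FIPow.unit m).app n)
      naturality n n' f := by
        change V.map f ≫ V.map _ = V.map _ ≫ V.map _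
        rw [← V.map_comp, ← V.map_comp]
        exact congrArg V.map (FIPow.comp_unit_app f) }
  naturality V V' φ := by
    ext n : 2
    exact (φ.naturality _).symm

instance : (shift k m).Additive where

instance : PreservesFiniteLimits (shift k m) := ⟨fun _ _ _ => inferInstance⟩

instance : PreservesFiniteColimits (shift k m) := ⟨fun _ _ _ => inferInstance⟩

instance : (shift k m).PreservesInjectiveObjects := by
  have (x : FIPow m) : HasColimitsOfShape (CostructuredArrow (FIPow.shift m) x) (ModuleCat.{u} k) :=
    inferInstance
  have (x : FIPow m) : HasExactColimitsOfShape (CostructuredArrow (FIPow.shift m) x)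
      (ModuleCat.{u} k) :=
    hasExactColimitsOfShape_of_final _ (Discrete.functor (FIPow.pointed (x := x)))
  have := preservesMonomorphisms_lan (FIPow.shift m) (ModuleCat.{u} k)
  exact Functor.preservesInjectiveObjects_of_adjunction_of_preservesMonomorphisms
    ((FIPow.shift m).lanAdjunction (ModuleCat.{u} k))

end Shift

section Torsion

variable {k : Type u} [CommRing k] {m : ℕ}

theorem isTorsionElt_shift_iff [NeZero m] (V : FIModule k m) (n : FIPow m)
    (v : V.obj ((FIPow.shift m).obj n)) :
    IsTorsionElt ((shift k m).obj V) n v ↔ IsTorsionElt V ((FIPow.shift m).obj n) v := by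
  constructor
  · rintro ⟨r, f, ⟨j, hj⟩, hv⟩
    rw [FI.not_isIso_iff] at hj
    exact ⟨_, (FIPow.shift m).map f, ⟨j, FI.not_isIso_of_lt _ (Nat.succ_lt_succ hj)⟩, hv⟩
  · -- A shifted inclusion `g` into a large enough object factors through `f`.
    rintro ⟨r, f, -, hv⟩
    let N : FIPow m := fun j => ⟨(n j).n + (r j).n + 1⟩
    have n_lt (j : Fin m) : (n j).n < (N j).n := by simp only [N]; omega
    let g : n ⟶ N := fun j => (Fin.castLEEmb (n_lt j).le : Fin (n j).n ↪ Fin (N j).n)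
    obtain ⟨h, hh⟩ := FIPow.exists_comp_eq f ((FIPow.shift m).map g) fun j => by
      change (r j).n ≤ (n j).n + (r j).n + 1 + 1
      omega
    refine ⟨N, g, ⟨0, FI.not_isIso_of_lt _ (n_lt 0)⟩, ?_⟩
    change V.map ((FIPow.shift m).map g) v = 0
    rw [← hh, V.map_comp, ModuleCat.comp_apply, hv, map_zero]

theorem isTorsionElt_of_mono {V V' : FIModule k m} (φ : V ⟶ V') [Mono φ] {n : FIPow m}
    {v : V.obj n} (hv : IsTorsionElt V' n (φ.app n v)) : IsTorsionElt V n v := by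
  obtain ⟨r, f, hf, h₀⟩ := hv
  refine ⟨r, f, hf, (ModuleCat.mono_iff_injective _).1
    ((NatTrans.mono_iff_mono_app φ).1 inferInstance r) ?_⟩
  rw [← ModuleCat.comp_apply, φ.naturality, ModuleCat.comp_apply, h₀, map_zero]

theorem isTorsionElt_torsion [NeZero m] (V : FIModule k m) (n : FIPow m)
    (v : (torsion V).obj n) : IsTorsionElt (torsion V) n v := by
  obtain ⟨r, f, hf, h₀⟩ := v.2
  exact ⟨r, f, hf, Subtype.ext h₀⟩

variable (V : FIModule k m) [Mono ((shiftUnit k m).app V)]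

theorem exists_hom_injective_map (n : FIPow m) (N : ℕ) :
    ∃ (c : FIPow m) (g : n ⟶ c), (∀ j, N ≤ (c j).n) ∧ Function.Injective (V.map g) := by
  induction N with
  | zero => exact ⟨n, 𝟙 n, fun j => Nat.zero_le _, by simpa using Function.injective_id⟩
  | succ N ih =>
    obtain ⟨c, g, hc, hg⟩ := ih
    have injective_map_unit : Function.Injective (V.map ((FIPow.unit m).app c)) :=
      (ModuleCat.mono_iff_injective _).1
        ((NatTrans.mono_iff_mono_app ((shiftUnit k m).app V)).1 inferInstance c)
    have map_comp : V.map (g ≫ (FIPow.unit m).app c) = V.map g ≫ V.map ((FIPow.unit m).app c) :=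
      V.map_comp _ _
    refine ⟨_, g ≫ (FIPow.unit m).app c, fun j => Nat.succ_le_succ (hc j), ?_⟩
    rw [map_comp]
    exact injective_map_unit.comp hg

variable {V}

theorem eq_zero_of_isTorsionElt {n : FIPow m} {v : V.obj n} (hv : IsTorsionElt V n v) :
    v = 0 := by
  obtain ⟨r, f, -, hv⟩ := hv
  obtain ⟨c, g, hc, hg⟩ := exists_hom_injective_map V n (∑ j, (r j).n)
  obtain ⟨h, rfl⟩ := FIPow.exists_comp_eq f g fun j =>
    (Finset.single_le_sum (f := fun j => (r j).n) (fun _ _ => Nat.zero_le _)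
      (Finset.mem_univ j)).trans (hc j)
  refine hg ?_
  rw [V.map_comp, ModuleCat.comp_apply, hv, map_zero, map_zero]

end Torsion

section LocalCohomology

variable {k : Type u} [CommRing k] {m : ℕ} [NeZero m]

variable (k m) in
/-- The torsion functor commutes with the shift. -/
def torsionShiftIso : shift k m ⋙ torsionFunctor k m ≅ torsionFunctor k m ⋙ shift k m :=
  NatIso.ofComponents
    (fun V => NatIso.ofComponents
      (fun n => (LinearEquiv.ofEq (torsionSubmodule ((shift k m).obj V) n)
        (torsionSubmodule V ((FIPow.shift m).obj n))
        (Submodule.ext fun v => isTorsionElt_shift_iff V n v)).toModuleIso)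
      (fun _ => rfl))
    (fun _ => rfl)

theorem mono_shiftUnit_localCohomology (V : FIModule k m) [IsSplitMono ((shiftUnit k m).app V)]
    (i : ℕ) : Mono ((shiftUnit k m).app ((localCohomology k m i).obj V)) :=
  mono_app_rightDerived (shiftUnit k m) (torsionShiftIso k m) (fun _ => rfl) V i

theorem isTorsionElt_localCohomology (V : FIModule k m) (i : ℕ) (n : FIPow m)
    (v : ((localCohomology k m i).obj V).obj n) : IsTorsionElt _ n v := by
  let I := injectiveResolution V
  let K := ((torsionFunctor k m).mapHomologicalComplex (ComplexShape.up ℕ)).obj I.cocomplex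
  have isTorsionElt_cycles (w : (K.cycles i).obj n) : IsTorsionElt (K.cycles i) n w :=
    isTorsionElt_of_mono (K.iCycles i) (isTorsionElt_torsion (I.cocomplex.X i) n _)
  have isTorsionElt_homology (w : (K.homology i).obj n) : IsTorsionElt (K.homology i) n w := by
    obtain ⟨w, rfl⟩ := (ModuleCat.epi_iff_surjective _).1
      ((NatTrans.epi_iff_epi_app (K.homologyπ i)).1 inferInstance n) w
    exact (isTorsionElt_cycles w).app _
  exact isTorsionElt_of_mono (I.isoRightDerivedObj (torsionFunctor k m) i).hom
    (isTorsionElt_homology _)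

theorem isZero_localCohomology_of_isSplitMono (V : FIModule k m)
    [IsSplitMono ((shiftUnit k m).app V)] (i : ℕ) : IsZero ((localCohomology k m i).obj V) := by
  have := mono_shiftUnit_localCohomology V i
  have eq_zero (n : FIPow m) (v : ((localCohomology k m i).obj V).obj n) : v = 0 :=
    eq_zero_of_isTorsionElt (isTorsionElt_localCohomology V i n v)
  refine (Functor.isZero_iff _).2 fun n => ?_
  have : Subsingleton (((localCohomology k m i).obj V).obj n) :=
    subsingleton_of_forall_eq 0 (eq_zero n)
  exact ModuleCat.isZero_of_subsingleton _

end LocalCohomology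

end FIModule

/-! ### Induced and semi-induced modules -/

theorem comapDomain_mapDomain_of_cartesian {α β γ δ M : Type*} [AddCommMonoid M] {i : α → β}
    {j : γ → δ} {p : α → γ} {q : β → δ} (hi : Function.Injective i) (hj : Function.Injective j)
    (comm : ∀ a, q (i a) = j (p a)) (cartesian : ∀ b c, q b = j c → b ∈ Set.range i) (x : β →₀ M) :
    (x.mapDomain q).comapDomain j hj.injOn = (x.comapDomain i hi.injOn).mapDomain p := by
  classical
  induction x using Finsupp.induction_linear with
  | zero => simp only [Finsupp.mapDomain_zero, Finsupp.comapDomain_zero]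
  | add x y hx hy =>
    rw [Finsupp.mapDomain_add, Finsupp.comapDomain_add_of_injective hj, hx, hy,
      Finsupp.comapDomain_add_of_injective hi, Finsupp.mapDomain_add]
  | single b s =>
    rw [Finsupp.mapDomain_single]
    by_cases hb : b ∈ Set.range i
    · obtain ⟨a, rfl⟩ := hb
      rw [Finsupp.comapDomain_single, Finsupp.mapDomain_single]
      simp only [comm, Finsupp.comapDomain_single]
    · have comapDomain_eq_zero : (Finsupp.single b s).comapDomain i hi.injOn = 0 :=
        Finsupp.ext fun a => Finsupp.single_eq_of_ne fun h => hb ⟨a, h⟩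
      rw [comapDomain_eq_zero, Finsupp.mapDomain_zero]
      exact Finsupp.ext fun c => Finsupp.single_eq_of_ne fun h => hb (cartesian b c h.symm)

namespace FIModule

open FIPow TensorProduct

section Retraction

variable {k : Type u} [CommRing k] {m : ℕ} {r : FIPow m}

/-- The linear map `k[Hom(r, n + (1, …, 1))] ⟶ k[Hom(r, n)]` that restricts the morphisms missing
the new elements to `n` and kills all others. -/
noncomputable def restrict (k : Type u) [CommRing k] (r n : FIPow m) :
    ((r ⟶ (FIPow.shift m).obj n) →₀ k) →ₗ[k] ((r ⟶ n) →₀ k) :=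
  Finsupp.lcomapDomain (fun g => g ≫ (unit m).app n) (comp_unit_app_injective r n)

theorem restrict_mapDomain_comp_unit {n : FIPow m} (x : (r ⟶ n) →₀ k) :
    restrict k r n (x.mapDomain fun g => g ≫ (unit m).app n) = x :=
  Finsupp.comapDomain_mapDomain _ (comp_unit_app_injective r n) x

theorem restrict_mapDomain_comp_shift_map {n n' : FIPow m} (h : n ⟶ n')
    (x : (r ⟶ (FIPow.shift m).obj n) →₀ k) :
    restrict k r n' (x.mapDomain fun f => f ≫ (FIPow.shift m).map h) =
      (restrict k r n x).mapDomain fun g => g ≫ h := by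
  refine comapDomain_mapDomain_of_cartesian (comp_unit_app_injective r n)
    (comp_unit_app_injective r n') (fun g => ?_)
    (fun f _ hg => exists_comp_unit_eq_of_comp_shift_map_eq f h hg) x
  rw [Category.assoc, Category.assoc, comp_unit_app]

theorem restrict_mapDomain_permHom_comp {n : FIPow m} (σ : SymGroup r)
    (x : (r ⟶ (FIPow.shift m).obj n) →₀ k) :
    restrict k r n (x.mapDomain fun f => permHom σ ≫ f) =
      (restrict k r n x).mapDomain fun g => permHom σ ≫ g := by
  have := isIso_permHom σ
  refine comapDomain_mapDomain_of_cartesian (comp_unit_app_injective r n)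
    (comp_unit_app_injective r n) (fun g => (Category.assoc _ _ _).symm)
    (fun f g hg => ⟨inv (permHom σ) ≫ g, ?_⟩) x
  exact (Category.assoc _ _ _).trans ((IsIso.inv_comp_eq _).2 hg.symm)

variable {W : Type u} [AddCommGroup W] [Module k W] (ρ : Representation k (SymGroup r) W)

theorem mapDomain_permHom_sub_mem_inducedRel {n : FIPow m} (σ : SymGroup r) (x : (r ⟶ n) →₀ k)
    (w : W) : x.mapDomain (fun g => permHom σ ≫ g) ⊗ₜ[k] w - x ⊗ₜ[k] ρ σ w ∈ inducedRel ρ n := by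
  induction x using Finsupp.induction_linear with
  | zero => simp only [Finsupp.mapDomain_zero, zero_tmul, sub_zero, zero_mem]
  | add x y hx hy =>
    rw [Finsupp.mapDomain_add, add_tmul, add_tmul, add_sub_add_comm]
    exact add_mem hx hy
  | single g c =>
    have h := (inducedRel ρ n).smul_mem c (Submodule.subset_span ⟨g, σ, w, rfl⟩)
    rw [smul_sub, smul_tmul', smul_tmul', Finsupp.smul_single, Finsupp.smul_single, smul_eq_mul,
      mul_one] at h
    rwa [Finsupp.mapDomain_single]

theorem inducedRel_le_comap_rTensor_restrict (n : FIPow m) :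
    inducedRel ρ ((FIPow.shift m).obj n) ≤
      (inducedRel ρ n).comap ((restrict k r n).rTensor W) := by
  refine Submodule.span_le.2 ?_
  rintro _ ⟨f, σ, w, rfl⟩
  have h := mapDomain_permHom_sub_mem_inducedRel ρ σ (restrict k r n (Finsupp.single f 1)) w
  rw [← restrict_mapDomain_permHom_comp, Finsupp.mapDomain_single] at h
  rwa [SetLike.mem_coe, Submodule.mem_comap, map_sub, LinearMap.rTensor_tmul,
    LinearMap.rTensor_tmul]

/-- The retraction of the natural map from an induced module to its shift. -/
noncomputable def retraction : (shift k m).obj (induced ρ) ⟶ induced ρ where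
  app n := ModuleCat.ofHom (Submodule.mapQ _ _ ((restrict k r n).rTensor W)
    (inducedRel_le_comap_rTensor_restrict ρ n))
  naturality n n' h := by
    ext : 1
    refine Submodule.linearMap_qext _ (TensorProduct.ext' fun x w => ?_)
    exact congrArg (fun y => Submodule.Quotient.mk (y ⊗ₜ[k] w))
      (restrict_mapDomain_comp_shift_map h x)

theorem shiftUnit_app_comp_retraction :
    (shiftUnit k m).app (induced ρ) ≫ retraction ρ = 𝟙 (induced ρ) := by
  ext n : 3
  refine Submodule.linearMap_qext _ (TensorProduct.ext' fun x w => ?_)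
  exact congrArg (fun y => Submodule.Quotient.mk (y ⊗ₜ[k] w)) (restrict_mapDomain_comp_unit x)

instance isSplitMono_shiftUnit_app_induced : IsSplitMono ((shiftUnit k m).app (induced ρ)) :=
  ⟨⟨retraction ρ, shiftUnit_app_comp_retraction ρ⟩⟩

end Retraction

variable {k : Type u} [CommRing k] {m : ℕ} [NeZero m]

theorem IsInduced.isZero_localCohomology {V : FIModule k m} (hV : V.IsInduced) (i : ℕ) :
    IsZero ((localCohomology k m i).obj V) := by
  obtain ⟨r, W, _, _, ρ, ⟨e⟩⟩ := hV
  exact (isZero_localCohomology_of_isSplitMono (induced ρ) i).of_iso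
    ((localCohomology k m i).mapIso e)

theorem isZero_localCohomology_of_mono {V V' : FIModule k m} (φ : V ⟶ V') [Mono φ] (i : ℕ)
    (hV : IsZero ((localCohomology k m i).obj V))
    (hφ : IsZero ((localCohomology k m i).obj (cokernel φ))) :
    IsZero ((localCohomology k m i).obj V') :=
  (exact_map_rightDerived (S := ShortComplex.mk φ _ (cokernel.condition φ))
    { exact := ShortComplex.exact_cokernel φ } (torsionFunctor k m) i).isZero_of_both_zeros
      (hV.eq_of_src _ _) (hφ.eq_of_tgt _ _)

end FIModule

theorem mainTheorem7_general {k : Type u} [CommRing k] {m : ℕ} [NeZero m] (V : FIModule k m)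
    (hV : V.IsSemiInduced) (i : ℕ) :
    IsZero ((FIModule.localCohomology k m i).obj V) := by
  obtain ⟨l, F, hF₀, hF_last, hF⟩ := hV
  have isZero_filtration (j : Fin (l + 1)) :
      IsZero ((FIModule.localCohomology k m i).obj (F j : FIModule k m)) := by
    induction j using Fin.induction with
    | zero =>
      rw [hF₀]
      exact Functor.map_isZero ((FIModule.torsionFunctor k m).rightDerived i)
        ((isZero_zero _).of_iso Subobject.botCoeIsoZero)
    | succ j ih =>
      obtain ⟨h, hj⟩ := hF j
      exact FIModule.isZero_localCohomology_of_mono (Subobject.ofLE _ _ h) i ih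
        (hj.isZero_localCohomology i)
  have e : (F (Fin.last l) : FIModule k m) ≅ V := by
    rw [hF_last]
    exact asIso (⊤ : Subobject V).arrow
  exact (isZero_filtration (Fin.last l)).of_iso ((FIModule.localCohomology k m i).mapIso e.symm)

theorem mainTheorem7 {k : Type u} [CommRing k] [IsNoetherianRing k] {m : ℕ} [NeZero m]
    (V : FIModule k m) (hV : V.IsSemiInduced) (i : ℕ) :
    CategoryTheory.Limits.IsZero ((FIModule.localCohomology k m i).obj V) :=
  mainTheorem7_general V hV i
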